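/- Let $k$ be a field, $n\ge 0$, $S=k[x_1,\dots,x_n]$ with its standard grading, and let $I\subseteq S$ be a homogeneous ideal. For a total order of the variables $x_{\pi(1)}>x_{\pi(2)}>\dots>x_{\pi(n)}$, the associated degree reverse lexicographic order compares monomials $x^a, x^b$ by $x^a<x^b$ if and only if $\deg x^a<\deg x^b$, or $\deg x^a=\deg x^b$ and $a_{\pi(i)}>b_{\pi(i)}$ for the largest $i$ with $a_{\pi(i)}\ne b_{\pi(i)}$. A set $\mathcal G\subseteq I$ is a Gröbner basis of $I$ with respect to a monomial order if the leading terms of the elements of $\mathcal G$ generate the ideal generated by the leading terms of all elements of $I$. A homogeneous polynomial $f\in S$ is called tidy if each variable of $S$ divides at most one monomial in the support of $f$. **Theorem.** Suppose that there is a set $\mathcal G$ of tidy homogeneous polynomials of degree $2$ that is a Gröbner basis of $I$ with respect to the degree reverse lexicographic orders associated with all $n!$ total orders of the variables. Then $R=S/I$ is strongly Koszul with respect to the variables; that is, $R$ is a standard graded $k$-algebra, the residue classes $\overline{x}_1,\dots,\overline{x}_n$ form a $k$-basis of $R_1$, and for every subset $A\subsetneq\{\overline{x}_1,\dots,\overline{x}_n\}$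 and every $\overline{x}_i\notin A$ the colon ideal $(a\mid a\in A):_R\overline{x}_i$ is generated by a subset of $\{\overline{x}_1,\dots,\overline{x}_n\}$. -/

import Mathlib

noncomputable section

/-! ### Degree reverse lexicographic orders -/

/-- Exponent vectors in `n` variables, to be equipped with the degree reverse lexicographic order
for which `X (π 0) > X (π 1) > ⋯ > X (π (n - 1))`. -/
def DegRevLex (n : ℕ) (_π : Equiv.Perm (Fin n)) : Type := Fin n →₀ ℕ

namespace DegRevLex

variable {n : ℕ} {π : Equiv.Perm (Fin n)}

instance : AddCommMonoid (DegRevLex n π) := inferInstanceAs (AddCommMonoid (Fin n →₀ ℕ))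

/-- The additive bijection between exponent vectors and the synonym. -/
def ofExp (n : ℕ) (π : Equiv.Perm (Fin n)) : (Fin n →₀ ℕ) ≃+ DegRevLex n π :=
  AddEquiv.refl (Fin n →₀ ℕ)

/-- Compare degrees first; in case of a tie, compare lexicographically the exponents of
`X (π (n - 1)), …, X (π 0)`, a smaller exponent being better. -/
def key (a : DegRevLex n π) : ℕ ×ₗ Lex (Fin n → ℕᵒᵈ) :=
  toLex (((ofExp n π).symm a).degree,
    toLex fun i => OrderDual.toDual ((ofExp n π).symm a (π (Fin.rev i))))

theorem key_injective : Function.Injective (key (n := n) (π := π)) := by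
  intro a b h
  apply (ofExp n π).symm.injective
  have h2 := congrArg (fun z => (ofLex z).2) h
  ext j
  have := congrFun (congrArg ofLex h2) (Fin.rev (π.symm j))
  simpa [key] using this

instance : LinearOrder (DegRevLex n π) := LinearOrder.lift' key key_injective

/-- The usual description of the degree reverse lexicographic order. -/
theorem lt_iff (a b : Fin n →₀ ℕ) :
    ofExp n π a < ofExp n π b ↔ a.degree < b.degree ∨
      (a.degree = b.degree ∧ ∃ i, (∀ j, i < j → a (π j) = b (π j)) ∧ b (π i) < a (π i)) := by
  change key (ofExp n π a) < key (ofExp n π b) ↔ _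
  simp only [key, AddEquiv.symm_apply_apply, Prod.Lex.toLex_lt_toLex]
  refine or_congr Iff.rfl (and_congr Iff.rfl ?_)
  constructor
  · rintro ⟨i, h1, h2⟩
    refine ⟨Fin.rev i, fun j hj => ?_, by simpa using h2⟩
    have := h1 (Fin.rev j) (Fin.rev_lt_iff.mpr hj)
    simpa using this
  · rintro ⟨i, h1, h2⟩
    refine ⟨Fin.rev i, fun j hj => ?_, by simpa using h2⟩
    have := h1 (Fin.rev j) (Fin.lt_rev_iff.mp hj)
    simpa using this

theorem add_lt_add_left_iff (a b c : DegRevLex n π) : c + a < c + b ↔ a < b := by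
  obtain ⟨a, rfl⟩ := (ofExp n π).surjective a
  obtain ⟨b, rfl⟩ := (ofExp n π).surjective b
  obtain ⟨c, rfl⟩ := (ofExp n π).surjective c
  rw [← map_add, ← map_add, lt_iff, lt_iff]
  simp

instance : IsOrderedAddMonoid (DegRevLex n π) where
  add_le_add_left a b h c := by
    rw [← not_lt] at h ⊢
    rwa [add_comm a, add_comm b, add_lt_add_left_iff]

theorem ofExp_monotone : Monotone (ofExp n π) := by
  intro a b h
  obtain ⟨c, rfl⟩ := exists_add_of_le h
  rw [← not_lt, lt_iff]
  rintro (h | ⟨h, i, -, hi⟩)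
  · simp at h
  · have hc : c = 0 := by simpa [Finsupp.degree_eq_zero_iff] using h
    simp [hc] at hi

instance : WellFoundedLT (DegRevLex n π) where
  wf := by
    rw [RelEmbedding.wellFounded_iff_isEmpty]
    refine ⟨fun f => ?_⟩
    obtain ⟨i, j, hij, h⟩ :=
      wellQuasiOrdered_le (α := Fin n →₀ ℕ) fun i => (ofExp n π).symm (f i)
    have h1 : f i ≤ f j := by simpa using ofExp_monotone (π := π) h
    exact absurd h1 (not_le.mpr (f.map_rel_iff.mpr hij))

end DegRevLex

/-- The degree reverse lexicographic order with `X (π 0) > X (π 1) > ⋯ > X (π (n - 1))`, as a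
monomial order. -/
def MonomialOrder.degRevLex {n : ℕ} (π : Equiv.Perm (Fin n)) : MonomialOrder (Fin n) where
  syn := DegRevLex n π
  toSyn := DegRevLex.ofExp n π
  toSyn_monotone := DegRevLex.ofExp_monotone

/-! ### Gröbner bases and tidy polynomials -/

/-- `G` is a Gröbner basis of the ideal `I` with respect to the monomial order `m`: it is contained
in `I` and its leading terms generate the initial ideal of `I`. -/
def IsGroebnerBasis {k : Type*} [Field k] {n : ℕ} (m : MonomialOrder (Fin n))
    (G : Set (MvPolynomial (Fin n) k)) (I : Ideal (MvPolynomial (Fin n) k)) : Prop :=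
  G ⊆ I ∧
    Ideal.span (m.leadingTerm '' G) =
      Ideal.span (m.leadingTerm '' (I : Set (MvPolynomial (Fin n) k)))

/-- `G` is a Gröbner basis of `I` with respect to the degree reverse lexicographic orders attached
to all orderings of the variables. -/
def IsRevlexUniversalGroebnerBasis {k : Type*} [Field k] {n : ℕ}
    (G : Set (MvPolynomial (Fin n) k)) (I : Ideal (MvPolynomial (Fin n) k)) : Prop :=
  ∀ π : Equiv.Perm (Fin n), IsGroebnerBasis (MonomialOrder.degRevLex π) G I

/-- A tidy polynomial: homogeneous, and each variable divides at most one monomial of its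
support. -/
def IsTidy {k : Type*} [Field k] {n : ℕ} (f : MvPolynomial (Fin n) k) : Prop :=
  (∃ d : ℕ, f.IsHomogeneous d) ∧
    ∀ i : Fin n, ∀ a ∈ f.support, ∀ b ∈ f.support, a i ≠ 0 → b i ≠ 0 → a = b

/-! ### Standard graded algebras and strong Koszulness -/

/-- The family `𝒜` makes `R` a standard graded `k`-algebra: `R` is the direct sum of the `𝒜 d`,
multiplication respects degrees, `𝒜 0 = k`, and `R` is generated as a `k`-algebra by the
finite-dimensional space `𝒜 1`. -/
structure IsStandardGraded {k R : Type*} [Field k] [CommRing R] [Algebra k R]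
    (𝒜 : ℕ → Submodule k R) : Prop where
  gradedMonoid : SetLike.GradedMonoid 𝒜
  isInternal : DirectSum.IsInternal 𝒜
  algebraMap_injective : Function.Injective (algebraMap k R)
  degree_zero : 𝒜 0 = 1
  degree_one_finite : Module.Finite k (𝒜 1)
  adjoin_degree_one : Algebra.adjoin k (𝒜 1 : Set R) = ⊤

/-- The standard graded algebra `R` is strongly Koszul with respect to the family `b`: the family
is a `k`-basis of the degree one part, and for every set `A` of members of `b` and every member
`b i` outside `A`, the colon ideal `(A) : b i` is generated by members of `b`. -/
structure IsStronglyKoszul {k R ι : Type*} [Field k] [CommRing R] [Algebra k R]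
    (𝒜 : ℕ → Submodule k R) (b : ι → R) : Prop where
  isStandardGraded : IsStandardGraded 𝒜
  linearIndependent : LinearIndependent k b
  span_eq : Submodule.span k (Set.range b) = 𝒜 1
  colon_eq : ∀ (A : Set ι) (i : ι), i ∉ A →
    ∃ C : Set ι, (Ideal.span (b '' A)).colon {b i} = Ideal.span (b '' C)

/-- The grading of `k[x₁, …, xₙ] / I` induced by the degree: the piece of degree `d` consists of
the classes of the forms of degree `d`. -/
def quotientGrading {k : Type*} [Field k] {n : ℕ} (I : Ideal (MvPolynomial (Fin n) k)) (d : ℕ) :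
    Submodule k (MvPolynomial (Fin n) k ⧸ I) :=
  (MvPolynomial.homogeneousSubmodule (Fin n) k d).map (Ideal.Quotient.mkₐ k I).toLinearMap

end

attribute [local instance] MvPolynomial.gradedAlgebra

open MvPolynomial

/-! Fix `A` and `i ∉ A`, put J = I + (A), and let D be the set of j with x_j x_i ∈ J. The claim is
that J : x_i = I + (D). The key is to use the revlex order adapted to the pair: variables of A
smallest, x_i just above them, all others larger.

Let f x_i ∈ J with f ≠ 0; by induction on leading terms it suffices to match in(f) by an element of
both J : x_i and I + (D). If a variable of D divides in(f), take the leading term itself. Otherwise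
in(f) avoids A ⊆ D, and since monomials meeting A are the smallest of their degree, in(f) x_i is the
leading monomial of an element of I (`exists_degree_eq_of_mul_X_mem`). So some in(g), g ∈ G, divides
in(f) x_i. If x_i does not divide in(g), then in(g) divides in(f) and a multiple of g works. If
in(g) = x_i x_j, tidiness keeps x_i out of the other monomials of g; being smaller, they must meet
A, so x_i x_j ∈ J (`IsTidy.monomial_mem_sup`). Then j ∈ D and x_j divides in(f), a contradiction. -/

/-- If the ordering `π` lists the variables by increasing rank `r`, a monomial involving a variable
of rank at least `c` is smaller than every monomial of the same degree that involves none. -/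
theorem DegRevLex.lt_of_rank {n : ℕ} {π : Equiv.Perm (Fin n)} {r : Fin n → ℕ}
    (hr : Monotone (r ∘ π)) (c : ℕ) {a b : Fin n →₀ ℕ} (hdeg : a.degree = b.degree)
    (ha : ∃ l, c ≤ r l ∧ a l ≠ 0) (hb : ∀ l, c ≤ r l → b l = 0) :
    DegRevLex.ofExp n π a < DegRevLex.ofExp n π b := by
  obtain ⟨l, hl, hal⟩ := ha
  -- `t` is the position of the smallest variable dividing `a`; from there on `b` vanishes.
  obtain ⟨t, ht, htmax⟩ :=
    (Finset.univ.filter fun t : Fin n => a (π t) ≠ 0).exists_maximal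
      ⟨π.symm l, by simpa using hal⟩
  have hat : a (π t) ≠ 0 := by simpa using ht
  have hzero : ∀ j, t < j → a (π j) = 0 := fun j hj => by
    by_contra h
    exact absurd (htmax (by simpa using h) hj.le) (not_le.mpr hj)
  have hlt : π.symm l ≤ t := by
    by_contra h
    exact hal (by simpa using hzero _ (not_le.mp h))
  have hct : c ≤ r (π t) := hl.trans (by simpa using hr hlt)
  refine (DegRevLex.lt_iff a b).mpr (Or.inr ⟨hdeg, t, fun j hj => ?_, ?_⟩)
  · rw [hzero j hj, hb _ (hct.trans (hr hj.le))]
  · rw [hb _ hct]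
    exact Nat.pos_of_ne_zero hat

/-! ### Division by leading terms -/

section Groebner

variable {k : Type*} [Field k] {n : ℕ}

/-- The leading exponent of a nonzero element of `I` is divisible by that of a nonzero element of a
Gröbner basis. -/
theorem IsGroebnerBasis.exists_degree_le {m : MonomialOrder (Fin n)}
    {G : Set (MvPolynomial (Fin n) k)} {I : Ideal (MvPolynomial (Fin n) k)}
    (hG : IsGroebnerBasis m G I) {h : MvPolynomial (Fin n) k} (hI : h ∈ I) (h0 : h ≠ 0) :
    ∃ g ∈ G, g ≠ 0 ∧ m.degree g ≤ m.degree h := by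
  have hmem : m.leadingTerm h ∈ Ideal.span (m.leadingTerm '' G) := by
    rw [hG.2]
    exact Ideal.subset_span ⟨h, hI, rfl⟩
  have hle : Ideal.span (m.leadingTerm '' G) ≤
      Ideal.span ((fun s => monomial s (1 : k)) '' (m.degree '' {g ∈ G | g ≠ 0})) := by
    rw [Ideal.span_le]
    rintro _ ⟨g, hg, rfl⟩
    by_cases hg0 : g = 0
    · simp [hg0]
    have : m.leadingTerm g = C (m.leadingCoeff g) * monomial (m.degree g) 1 := by
      rw [C_mul_monomial, mul_one, MonomialOrder.leadingTerm]
    rw [this]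
    exact Ideal.mul_mem_left _ _ (Ideal.subset_span ⟨_, ⟨g, ⟨hg, hg0⟩, rfl⟩, rfl⟩)
  obtain ⟨_, ⟨g, hg, rfl⟩, hgh⟩ := mem_ideal_span_monomial_image.mp (hle hmem) (m.degree h) (by
    rw [m.support_leadingTerm' h0]
    simp)
  exact ⟨g, hg.1, hg.2, hgh⟩

/-- Subtracting a polynomial with the same leading term gives zero or lowers the degree. -/
theorem MonomialOrder.degree_sub_lt_of_leadingTerm_eq {σ : Type*} (m : MonomialOrder σ)
    {f p : MvPolynomial σ k} (h : m.leadingTerm p = m.leadingTerm f) (hne : f - p ≠ 0) :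
    m.toSyn (m.degree (f - p)) < m.toSyn (m.degree f) := by
  have hd : m.degree p = m.degree f := by
    rw [← m.degree_leadingTerm p, h, m.degree_leadingTerm]
  have hc : m.leadingCoeff p = m.leadingCoeff f := by
    rw [← m.leadingCoeff_leadingTerm p, h, m.leadingCoeff_leadingTerm]
  refine lt_of_le_of_ne ?_ fun he => ?_
  · simpa [hd] using m.degree_sub_le (f := f) (g := p)
  · have h1 := m.coeff_degree_ne_zero_iff.mpr hne
    rw [m.toSyn.injective he, coeff_sub] at h1
    apply h1
    have h2 : coeff (m.degree f) p = m.leadingCoeff p := by rw [← hd]; rfl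
    rw [h2, hc]
    exact sub_self _

/-- A set of polynomials closed under subtraction is contained in an additive subgroup `K` as soon
as each of its nonzero members shares its leading term with a member lying in `K`. -/
theorem MonomialOrder.mem_of_forall_exists_leadingTerm_eq {σ : Type*} (m : MonomialOrder σ)
    {Q K : AddSubgroup (MvPolynomial σ k)}
    (hstep : ∀ f ∈ Q, f ≠ 0 → ∃ p ∈ Q, p ∈ K ∧ m.leadingTerm p = m.leadingTerm f) : Q ≤ K := by
  suffices H : ∀ (s : m.syn) (f : MvPolynomial σ k), m.toSyn (m.degree f) = s → f ∈ Q → f ∈ K from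
    fun f hf => H _ f rfl hf
  intro s
  induction s using WellFoundedLT.induction with
  | ind s ih =>
    rintro f rfl hf
    by_cases h0 : f = 0
    · exact h0 ▸ K.zero_mem
    obtain ⟨p, hpQ, hpK, hp⟩ := hstep f hf h0
    by_cases hne : f - p = 0
    · exact sub_eq_zero.mp hne ▸ hpK
    have := ih _ (m.degree_sub_lt_of_leadingTerm_eq hp hne) _ rfl (Q.sub_mem hf hpQ)
    simpa using K.add_mem this hpK

theorem MvPolynomial.monomial_mem_span_X_image {σ : Type*} {C : Set σ} {j : σ} (hj : j ∈ C)
    {u : σ →₀ ℕ} (hu : u j ≠ 0) (c : k) : monomial u c ∈ Ideal.span (X '' C) := by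
  classical
  rw [mem_ideal_span_X_image]
  intro v hv
  have : v = u := by simpa using support_monomial_subset hv
  exact ⟨j, hj, this ▸ hu⟩

end Groebner

/-! ### Colon ideals of variables in the polynomial ring -/

section Colon

variable {k : Type*} [Field k] {n : ℕ} {I : Ideal (MvPolynomial (Fin n) k)}
  {G : Set (MvPolynomial (Fin n) k)}

/-- Suppose that the ordering lists the variables by increasing rank `r`, and that the variables of
positive rank are `i` and some members of `A`. If `xᵢ` divides the leading monomial of a tidy
quadric of `I`, then this monomial lies in `I + (A)`. -/
theorem IsTidy.monomial_mem_sup {π : Equiv.Perm (Fin n)} {r : Fin n → ℕ}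
    (hr : Monotone (r ∘ π)) {A : Set (Fin n)} {i : Fin n} (hi : 1 ≤ r i)
    (hA : ∀ l, 1 ≤ r l → l = i ∨ l ∈ A)
    {g : MvPolynomial (Fin n) k} (hg : g ∈ I) (hquad : g.IsHomogeneous 2) (htidy : IsTidy g)
    (hg0 : g ≠ 0) (hdi : (MonomialOrder.degRevLex π).degree g i ≠ 0) :
    monomial ((MonomialOrder.degRevLex π).degree g) 1 ∈ I ⊔ Ideal.span (X '' A) := by
  classical
  set m := MonomialOrder.degRevLex π
  have hc : m.leadingCoeff g ≠ 0 := by simpa using hg0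
  have hdg : m.degree g ∈ g.support := by simpa using hg0
  have hrest : g - m.leadingTerm g ∈ Ideal.span (X '' A) := by
    rw [mem_ideal_span_X_image]
    intro v hv
    have hvc : coeff v g - coeff v (m.leadingTerm g) ≠ 0 := by simpa using hv
    have hvd : v ≠ m.degree g := by
      rintro rfl
      apply hvc
      simp [MonomialOrder.leadingTerm, MonomialOrder.leadingCoeff]
    have hvg : v ∈ g.support := by
      rw [mem_support_iff]
      intro h
      apply hvc
      rw [h, MonomialOrder.leadingTerm, coeff_monomial, if_neg hvd.symm, sub_zero]
    by_contra hcon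
    push Not at hcon
    -- By tidiness x_i divides only the leading monomial. If `v` also avoids `A`, all its variables
    -- have rank 0, which makes it larger than the leading monomial.
    have hvi : v i = 0 := by
      by_contra h
      exact hvd (htidy.2 i v hvg _ hdg h hdi)
    have hlt := DegRevLex.lt_of_rank hr 1 (a := m.degree g) (b := v)
      ((hquad.degree_eq_sum_deg_support hdg).symm.trans (hquad.degree_eq_sum_deg_support hvg))
      ⟨i, hi, hdi⟩ (fun l hl => by
        rcases hA l hl with rfl | h
        · exact hvi
        · exact hcon l h)
    exact absurd (m.le_degree hvg) (not_le.mpr hlt)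
  have hlt : m.leadingTerm g ∈ I ⊔ Ideal.span (X '' A) := by
    have := sub_mem (Ideal.mem_sup_left (T := Ideal.span (X '' A)) hg) (Ideal.mem_sup_right hrest)
    simpa using this
  have : monomial (m.degree g) (1 : k) = C (m.leadingCoeff g)⁻¹ * m.leadingTerm g := by
    rw [MonomialOrder.leadingTerm, C_mul_monomial, inv_mul_cancel₀ hc]
  rw [this]
  exact Ideal.mul_mem_left _ _ hlt

/-- If `f xᵢ ∈ I + (A)` and the leading exponent of `f` involves no variable of `A`, then the
leading exponent of `f xᵢ` is the leading exponent of an element of `I`. -/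
theorem exists_degree_eq_of_mul_X_mem
    (hI : I.IsHomogeneous (homogeneousSubmodule (Fin n) k))
    {π : Equiv.Perm (Fin n)} {r : Fin n → ℕ} (hr : Monotone (r ∘ π)) {A : Set (Fin n)}
    (hA : ∀ l, 2 ≤ r l ↔ l ∈ A) {i : Fin n} (hiA : i ∉ A) {f : MvPolynomial (Fin n) k}
    (hf0 : f ≠ 0) (hf : f * X i ∈ I ⊔ Ideal.span (X '' A))
    (hu : ∀ l ∈ A, (MonomialOrder.degRevLex π).degree f l = 0) :
    ∃ h ∈ I, h ≠ 0 ∧ (MonomialOrder.degRevLex π).degree h =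
      (MonomialOrder.degRevLex π).degree f + Finsupp.single i 1 := by
  classical
  set m := MonomialOrder.degRevLex π
  set w := m.degree f + Finsupp.single i 1 with hw
  obtain ⟨h, hhI, a, ha, hsum⟩ := Submodule.mem_sup.mp hf
  have hcoeff : ∀ v : Fin n →₀ ℕ, (∀ l ∈ A, v l = 0) → coeff v h = coeff v (f * X i) := by
    intro v hv
    have : coeff v a = 0 := by
      by_contra hva
      obtain ⟨l, hl, hvl⟩ := mem_ideal_span_X_image.mp ha v (mem_support_iff.mpr hva)
      exact hvl (hv l hl)
    rw [← hsum, coeff_add, this, add_zero]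
  have hwA : ∀ l ∈ A, w l = 0 := fun l hl => by
    have : i ≠ l := fun e => hiA (e ▸ hl)
    simp [hw, hu l hl, this]
  have hdeg : m.degree (f * X i) = w := by
    rw [m.degree_mul hf0 (X_ne_zero i), m.degree_X]
  have hwc : coeff w (homogeneousComponent w.degree h) ≠ 0 := by
    rw [coeff_homogeneousComponent, if_pos rfl, hcoeff w hwA, ← hdeg]
    exact m.coeff_degree_ne_zero_iff.mpr (mul_ne_zero hf0 (X_ne_zero i))
  -- Revlex controls monomials meeting `A` only within one degree, hence the passage to a
  -- homogeneous component, which stays in `I`.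
  refine ⟨homogeneousComponent w.degree h, homogeneousComponent_mem_of_mem hI hhI _, ?_, ?_⟩
  · intro h0
    simp [h0] at hwc
  apply m.toSyn.injective
  refine le_antisymm (m.degree_le_iff.mpr fun v hv => ?_) (m.le_degree (mem_support_iff.mpr hwc))
  rw [support_homogeneousComponent, Finset.mem_filter] at hv
  by_cases hvA : ∀ l ∈ A, v l = 0
  · rw [← hdeg]
    exact m.le_degree (by rw [mem_support_iff, ← hcoeff v hvA]; exact mem_support_iff.mp hv.1)
  · push Not at hvA
    obtain ⟨l, hl, hvl⟩ := hvA
    exact (DegRevLex.lt_of_rank hr 2 hv.2 ⟨l, (hA l).mpr hl, hvl⟩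
      fun l hl => hwA l ((hA l).mp hl)).le

/-- Over a revlex universal Gröbner basis of tidy quadrics, `(I + (A)) : xᵢ` is contained in the sum
of `I` and the ideal generated by the variables it contains. -/
theorem mem_sup_span_X_of_mul_X_mem
    (hI : I.IsHomogeneous (homogeneousSubmodule (Fin n) k))
    (hquadric : ∀ g ∈ G, g.IsHomogeneous 2) (htidy : ∀ g ∈ G, IsTidy g)
    (hG : IsRevlexUniversalGroebnerBasis G I) {A : Set (Fin n)} {i : Fin n} (hiA : i ∉ A)
    {f : MvPolynomial (Fin n) k} (hf : f * X i ∈ I ⊔ Ideal.span (X '' A)) :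
    f ∈ I ⊔ Ideal.span (X '' {j | (X j * X i : MvPolynomial (Fin n) k) ∈
      I ⊔ Ideal.span (X '' A)}) := by
  classical
  set J := I ⊔ Ideal.span (X '' A) with hJ
  set D : Set (Fin n) := {j | (X j * X i : MvPolynomial (Fin n) k) ∈ J} with hD
  set K := I ⊔ Ideal.span (X '' D) with hK
  -- Higher rank means a smaller variable: sorting by `r` yields the order adapted to `A` and `i`.
  let r : Fin n → ℕ := fun l => if l ∈ A then 2 else if l = i then 1 else 0
  have hr : Monotone (r ∘ Tuple.sort r) := Tuple.monotone_sort r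
  have hrA : ∀ l, 2 ≤ r l ↔ l ∈ A := fun l => by
    simp only [r]
    split_ifs <;> simp_all
  have hri : 1 ≤ r i := by simp [r, hiA]
  have hrA' : ∀ l, 1 ≤ r l → l = i ∨ l ∈ A := fun l => by
    simp only [r]
    split_ifs <;> simp_all
  have hAD : A ⊆ D := fun l hl =>
    Ideal.mul_mem_right _ _ (Ideal.mem_sup_right (Ideal.subset_span (Set.mem_image_of_mem _ hl)))
  set m := MonomialOrder.degRevLex (Tuple.sort r) with hm
  refine m.mem_of_forall_exists_leadingTerm_eq
    (Q := (J.colon {X i}).toAddSubgroup) (K := K.toAddSubgroup) ?_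
    (show f ∈ J.colon {X i} from Submodule.mem_colon_singleton.mpr hf)
  intro f hf hf0
  replace hf : f * X i ∈ J := Submodule.mem_colon_singleton.mp hf
  suffices ∃ p, p * X i ∈ J ∧ p ∈ K ∧ m.leadingTerm p = m.leadingTerm f by
    obtain ⟨p, h1, h2⟩ := this
    exact ⟨p, Submodule.mem_colon_singleton.mpr h1, h2⟩
  by_cases hu : ∃ j ∈ D, m.degree f j ≠ 0
  · obtain ⟨j, hj, huj⟩ := hu
    have hmem := monomial_mem_span_X_image hj huj (m.leadingCoeff f)
    refine ⟨m.leadingTerm f, ?_, Ideal.mem_sup_right hmem, m.leadingTerm_leadingTerm f⟩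
    have hle : Ideal.span (X '' D) ≤ J.colon {X i} := by
      rw [Ideal.span_le]
      rintro _ ⟨l, hl, rfl⟩
      exact Submodule.mem_colon_singleton.mpr hl
    exact Submodule.mem_colon_singleton.mp (hle hmem)
  push Not at hu
  obtain ⟨h, hhI, hh0, hhd⟩ :=
    exists_degree_eq_of_mul_X_mem hI hr hrA hiA hf0 hf fun l hl => hu l (hAD hl)
  obtain ⟨g, hgG, hg0, hgh⟩ := (hG (Tuple.sort r)).exists_degree_le hhI hh0
  rw [hhd, ← hm] at hgh
  have hgI : g ∈ I := (hG (Tuple.sort r)).1 hgG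
  by_cases hdi : m.degree g i = 0
  · have hle : m.degree g ≤ m.degree f := fun l => by
      by_cases hl : l = i
      · simp [hl, hdi]
      · have := hgh l
        simpa [Finsupp.single_apply, Ne.symm hl] using this
    have hc : m.leadingCoeff g ≠ 0 := by simpa using hg0
    have hpI : monomial (m.degree f - m.degree g) (m.leadingCoeff f / m.leadingCoeff g) * g ∈ I :=
      Ideal.mul_mem_left _ _ hgI
    refine ⟨_, Ideal.mul_mem_right _ _ (Ideal.mem_sup_left hpI), Ideal.mem_sup_left hpI, ?_⟩
    rw [m.leadingTerm_mul, m.leadingTerm_monomial, MonomialOrder.leadingTerm, monomial_mul,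
      tsub_add_cancel_of_le hle, div_mul_cancel₀ _ hc, MonomialOrder.leadingTerm]
  -- Here in(g) = x_i x_j (possibly j = i), which forces j ∈ D although x_j divides in(f).
  · exfalso
    have hsingle : Finsupp.single i 1 ≤ m.degree g := by
      rw [Finsupp.single_le_iff]
      omega
    obtain ⟨e, he⟩ := exists_add_of_le hsingle
    have hdeg : (m.degree g).degree = 2 :=
      ((hquadric g hgG).degree_eq_sum_deg_support (by simpa using hg0)).symm
    rw [he, map_add, Finsupp.degree_single] at hdeg
    obtain ⟨j, hej⟩ : e ∈ Set.range fun j : Fin n => Finsupp.single j 1 := by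
      rw [Finsupp.range_single_one, Set.mem_ofPred_eq]
      omega
    have hmem := (htidy g hgG).monomial_mem_sup hr hri hrA' hgI (hquadric g hgG) hg0 hdi
    have hjD : j ∈ D := by
      rw [← hm, he, ← hej, add_comm] at hmem
      simpa [hD, X, monomial_mul] using hmem
    have hj0 := hu j hjD
    have := hgh j
    rw [he, ← hej] at this
    simp [hj0] at this

end Colon

/-! ### The standard grading of the quotient -/

section QuotientGrading

variable {k : Type*} [Field k] {n : ℕ} {I : Ideal (MvPolynomial (Fin n) k)}

theorem mem_quotientGrading {d : ℕ} {x : MvPolynomial (Fin n) k ⧸ I} :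
    x ∈ quotientGrading I d ↔ ∃ p : MvPolynomial (Fin n) k,
      p.IsHomogeneous d ∧ Ideal.Quotient.mk I p = x :=
  Iff.rfl

theorem quotientGrading_gradedMonoid : SetLike.GradedMonoid (quotientGrading I) where
  one_mem := ⟨1, isHomogeneous_one _ _, map_one (Ideal.Quotient.mk I)⟩
  mul_mem := by
    rintro _ _ _ _ ⟨p, hp, rfl⟩ ⟨q, hq, rfl⟩
    exact ⟨p * q, IsHomogeneous.mul hp hq, map_mul (Ideal.Quotient.mk I) _ _⟩

/-- If classes of forms of distinct degrees sum to zero, the sum of the forms lies in `I`, and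
homogeneity puts each form in `I`. -/
theorem quotientGrading_isInternal
    (hI : I.IsHomogeneous (homogeneousSubmodule (Fin n) k)) :
    DirectSum.IsInternal (quotientGrading I) := by
  classical
  constructor
  · rw [injective_iff_map_eq_zero]
    intro x hx
    choose p hp hpx using fun d => mem_quotientGrading.mp (x d).2
    have hsum : ∑ d ∈ DFinsupp.support x, p d ∈ I := by
      rw [← Ideal.Quotient.eq_zero_iff_mem, map_sum]
      rw [DirectSum.coeAddMonoidHom_eq_dfinsuppSum] at hx
      simpa [DFinsupp.sum, hpx] using hx
    ext d
    by_cases hd : d ∈ DFinsupp.support x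
    · have := homogeneousComponent_mem_of_mem hI hsum d
      rw [map_sum, Finset.sum_congr rfl fun e _ => homogeneousComponent_of_mem (hp e),
        Finset.sum_ite_eq, if_pos hd] at this
      rw [← hpx d, Ideal.Quotient.eq_zero_iff_mem.mpr this]
      rfl
    · rw [DFinsupp.notMem_support_iff.mp hd]
      rfl
  · intro x
    obtain ⟨p, rfl⟩ := Ideal.Quotient.mk_surjective x
    refine ⟨∑ d ∈ Finset.range (p.totalDegree + 1), DirectSum.of (fun d => quotientGrading I d) d
      ⟨_, mem_quotientGrading.mpr ⟨_, homogeneousComponent_isHomogeneous d p, rfl⟩⟩, ?_⟩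
    rw [map_sum]
    conv_rhs => rw [← sum_homogeneousComponent p, map_sum]
    exact Finset.sum_congr rfl fun d _ => DirectSum.coeAddMonoidHom_of _ _ _

theorem quotientGrading_zero : quotientGrading I 0 = 1 := by
  rw [quotientGrading, homogeneousSubmodule_zero]
  exact Submodule.map_one _

theorem quotientGrading_one :
    Submodule.span k (Set.range fun i : Fin n => Ideal.Quotient.mk I (X i)) =
      quotientGrading I 1 := by
  rw [quotientGrading, homogeneousSubmodule_one_eq_span_X, Submodule.map_span, ← Set.range_comp]
  rfl

theorem adjoin_quotientGrading_one :
    Algebra.adjoin k (quotientGrading I 1 : Set (MvPolynomial (Fin n) k ⧸ I)) = ⊤ := by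
  rw [← quotientGrading_one, Algebra.adjoin_span]
  have : (Set.range fun i : Fin n => Ideal.Quotient.mk I (X i)) =
      (Ideal.Quotient.mkₐ k I) '' Set.range X := by
    rw [← Set.range_comp]
    rfl
  rw [this, ← AlgHom.map_adjoin, adjoin_range_X, Algebra.map_top, AlgHom.range_eq_top]
  exact Ideal.Quotient.mkₐ_surjective k I

/-- An ideal with a Gröbner basis of quadrics contains no nonzero polynomial of degree at
most `1`. -/
theorem IsGroebnerBasis.eq_zero_of_totalDegree_le_one {m : MonomialOrder (Fin n)}
    {G : Set (MvPolynomial (Fin n) k)} (hG : IsGroebnerBasis m G I)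
    (hquadric : ∀ g ∈ G, g.IsHomogeneous 2) {h : MvPolynomial (Fin n) k} (hI : h ∈ I)
    (hdeg : h.totalDegree ≤ 1) : h = 0 := by
  by_contra h0
  obtain ⟨g, hg, hg0, hle⟩ := hG.exists_degree_le hI h0
  have h2 : (m.degree g).degree = 2 :=
    ((hquadric g hg).degree_eq_sum_deg_support (by simpa using hg0)).symm
  have h1 : (m.degree h).degree ≤ h.totalDegree := le_totalDegree (by simpa using h0)
  have := Finsupp.degree_mono hle
  omega

theorem IsGroebnerBasis.isStandardGraded {m : MonomialOrder (Fin n)}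
    {G : Set (MvPolynomial (Fin n) k)} (hG : IsGroebnerBasis m G I)
    (hI : I.IsHomogeneous (homogeneousSubmodule (Fin n) k))
    (hquadric : ∀ g ∈ G, g.IsHomogeneous 2) : IsStandardGraded (quotientGrading I) where
  gradedMonoid := quotientGrading_gradedMonoid
  isInternal := quotientGrading_isInternal hI
  algebraMap_injective := by
    rw [injective_iff_map_eq_zero]
    intro c hc
    have hmem : C c ∈ I := Ideal.Quotient.eq_zero_iff_mem.mp hc
    simpa using hG.eq_zero_of_totalDegree_le_one hquadric hmem (by simp)
  degree_zero := quotientGrading_zero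
  degree_one_finite := by
    rw [← quotientGrading_one]
    exact Module.Finite.span_of_finite k (Set.finite_range _)
  adjoin_degree_one := adjoin_quotientGrading_one

theorem IsGroebnerBasis.linearIndependent_mk_X {m : MonomialOrder (Fin n)}
    {G : Set (MvPolynomial (Fin n) k)} (hG : IsGroebnerBasis m G I)
    (hquadric : ∀ g ∈ G, g.IsHomogeneous 2) :
    LinearIndependent k fun i : Fin n => Ideal.Quotient.mk I (X i) := by
  refine LinearIndependent.map (f := (Ideal.Quotient.mkₐ k I).toLinearMap)
    (linearIndependent_X (Fin n) k) ?_
  rw [← homogeneousSubmodule_one_eq_span_X, Submodule.disjoint_def]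
  intro p hp hpI
  exact hG.eq_zero_of_totalDegree_le_one hquadric (Ideal.Quotient.eq_zero_iff_mem.mp hpI)
    (IsHomogeneous.totalDegree_le hp)

/-- Transfers colon computations in the quotient to the polynomial ring. -/
theorem mk_mem_span_mk_X_iff {A : Set (Fin n)} {p : MvPolynomial (Fin n) k} :
    Ideal.Quotient.mk I p ∈ Ideal.span ((fun i => Ideal.Quotient.mk I (X i)) '' A) ↔
      p ∈ I ⊔ Ideal.span (X '' A) := by
  have : (fun i : Fin n => Ideal.Quotient.mk I (X i)) '' A = Ideal.Quotient.mk I '' (X '' A) := by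
    rw [Set.image_image]
  rw [this, ← Ideal.map_span, ← Ideal.mem_comap,
    Ideal.comap_map_of_surjective' _ Ideal.Quotient.mk_surjective, Ideal.mk_ker, sup_comm]

end QuotientGrading

theorem mainTheorem1 {k : Type*} [Field k] {n : ℕ} (I : Ideal (MvPolynomial (Fin n) k))
    (hI : I.IsHomogeneous (MvPolynomial.homogeneousSubmodule (Fin n) k))
    (G : Set (MvPolynomial (Fin n) k))
    (hquadric : ∀ g ∈ G, g.IsHomogeneous 2)
    (htidy : ∀ g ∈ G, IsTidy g)
    (hG : IsRevlexUniversalGroebnerBasis G I) :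
    IsStronglyKoszul (quotientGrading I)
      (fun i : Fin n => Ideal.Quotient.mk I (MvPolynomial.X i)) := by
  -- Any single order suffices for these parts; only the colon condition needs the order to vary
  -- with `A` and `i`.
  refine ⟨(hG 1).isStandardGraded hI hquadric, (hG 1).linearIndependent_mk_X hquadric,
    quotientGrading_one, fun A i hi => ?_⟩
  refine ⟨{j | (X j * X i : MvPolynomial (Fin n) k) ∈ I ⊔ Ideal.span (X '' A)},
    le_antisymm ?_ (Ideal.span_le.mpr ?_)⟩
  · intro y hy
    obtain ⟨f, rfl⟩ := Ideal.Quotient.mk_surjective y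
    rw [Submodule.mem_colon_singleton, smul_eq_mul, ← map_mul, mk_mem_span_mk_X_iff] at hy
    exact mk_mem_span_mk_X_iff.mpr (mem_sup_span_X_of_mul_X_mem hI hquadric htidy hG hi hy)
  · rintro _ ⟨j, hj, rfl⟩
    rw [SetLike.mem_coe, Submodule.mem_colon_singleton, smul_eq_mul, ← map_mul,
      mk_mem_span_mk_X_iff]
    exact hj
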